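/- Fix an integer $d\ge 2$ and a constant $C>0$. In the pointer machine model, a data structure for a set $P$ of $n$ points in $\mathbb{R}^d$ is a finite directed graph of cells with a distinguished root; each cell stores at most one point of $P$ and at most two pointers to cells, and the space is the number of cells. To answer a query, a closed $d$-simplex $\gamma$, the algorithm starts at the root and repeatedly follows a pointer out of a cell already discovered, until each point of $P\cap\gamma$ is stored in some discovered cell; only pointer navigations are charged, and their choice is free (unlimited computational power, full knowledge of the structure). Suppose that, for all $n$, every set $P$ of $n$ points in $\mathbb{R}^d$ has such a data structure with at most $S(n)$ cells that answers every query with at most $Q(n)+Ck$ navigations, where $k=|P\cap\gamma|$. Then $$Q(n)=\Omega\!\left(\left(\frac{n^2}{S(n)}\right)^{(d-1)/d}\right),$$ and the query time bound satisfies $Q(n)+Ck=\Omega\big((n^2/S(n))^{(d-1)/d}+k\big)$ uniformly for $0\le k\le n$. In particular, for linear space, i.e. whenever $S(n)\le an$ with $a>0$ constant, $Q(n)=\Omega(n^{1-1/d})$ and $Q(n)+Ck=\Omega(n^{1-1/d}+k)$ uniformly for $0\le k\le n$. Here $\Omega$ means: up to a positive constant factor and for all $n\ge n_0$, where the factor and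 $n_0$ depend only on $d$ and $C$ (and on $a$ in the linear-space case). -/

import Mathlib

/-- A pointer-machine data structure over the input elements `α`: a finite directed graph with
`size` cells and a distinguished root.  A cell stores at most one input element and has two
pointers, each of which is null or leads to a cell. -/
structure PointerStructure (α : Type*) where
  size : ℕ
  root : Fin size
  store : Fin size → Option α
  ptr : Fin size → Bool → Option (Fin size)

namespace PointerStructure

/-- `M.Explores W t`: starting at the root, the algorithm can have discovered exactly the cells in
`W` after `t` pointer navigations.  A navigation follows a pointer out of any cell discovered so
far.  Only navigations are charged, and their choice is unrestricted. -/
inductive Explores {α : Type*} (M : PointerStructure α) : Finset (Fin M.size) → ℕ → Prop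
  | start : Explores M {M.root} 0
  | follow {W : Finset (Fin M.size)} {t : ℕ} {u v : Fin M.size} (b : Bool) :
      Explores M W t → u ∈ W → M.ptr u b = some v → Explores M (insert v W) (t + 1)

/-- The set `A` of input elements can be reported with at most `T` pointer navigations: some
exploration of this cost discovers, for each element of `A`, a cell storing it. -/
def ReportsWithin {α : Type*} (M : PointerStructure α) (A : Set α) (T : ℝ) : Prop :=
  ∃ (W : Finset (Fin M.size)) (t : ℕ), M.Explores W t ∧ (t : ℝ) ≤ T ∧
    ∀ p ∈ A, ∃ v ∈ W, M.store v = some p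

end PointerStructure

/-- The closed region of a (nondegenerate) `d`-simplex in `ℝ^d`. -/
def simplexRegion {d : ℕ} (γ : Affine.Simplex ℝ (EuclideanSpace ℝ (Fin d)) d) :
    Set (EuclideanSpace ℝ (Fin d)) :=
  convexHull ℝ (Set.range γ.points)

/-- Simplex range reporting on `n` points of `ℝ^d` is solved with at most `S` cells and query
time `Q + C * k`: each set `P` of `n` points has a pointer-machine structure with at most `S`
cells which, for each query simplex `γ`, reports `P ∩ γ` with at most `Q + C * k` navigations,
where `k = |P ∩ γ|`. -/
def SolvesSimplexReporting (d n : ℕ) (S Q C : ℝ) : Prop :=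
  ∀ P : Finset (EuclideanSpace ℝ (Fin d)), P.card = n →
    ∃ M : PointerStructure P, (M.size : ℝ) ≤ S ∧
      ∀ γ : Affine.Simplex ℝ (EuclideanSpace ℝ (Fin d)) d,
        M.ReportsWithin {p : P | (p : EuclideanSpace ℝ (Fin d)) ∈ simplexRegion γ}
          (Q + C * (Set.ncard {p : P | (p : EuclideanSpace ℝ (Fin d)) ∈ simplexRegion γ} : ℝ))

/-! The hard input is a set of n points in an integer grid of side about n^(1/d), queried along
hyperplanes with small integer normals. For a prime p, pigeonhole gives each vector (1, x, …,
x^(d-1)) mod p a nonzero multiple with integer representatives of size O(p^(1-1/d)). Such a normal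
takes only O(p^(1-1/d) n^(1/d)) values on the grid, so at least half the points lie on its
hyperplanes with at least h points, for a suitable h of order n^(1-1/d) / p^(1-1/d). Two points
share at most d-1 of all these hyperplanes, because a nonzero polynomial of degree below d has fewer
than d roots (`exists_vectors_in_general_position`).

If Q ≤ h, every rich hyperplane is reported in time proportional to its size. This forces many pairs
of its points to be stored within O(1) pointers of a common cell. Only O(S) pairs are that close,
and each serves at most d-1 hyperplanes (`sum_card_le_size`), so pn = O(S) (`mul_le_size`). A prime
p of order S/n with a large enough factor contradicts this, and then h has order (n²/S)^(1-1/d). -/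

namespace PointerStructure

/-! ### Counting in the pointer machine -/

variable {α : Type*} (M : PointerStructure α)

/-- The cells to which some pointer of `u` leads. -/
def children (u : Fin M.size) : Finset (Fin M.size) :=
  Finset.univ.filter fun v => ∃ b, M.ptr u b = some v

/-- The cells that can be reached from `w` along at most `g` pointers. -/
def nearby (w : Fin M.size) : ℕ → Finset (Fin M.size)
  | 0 => {w}
  | g + 1 => nearby w g ∪ (nearby w g).biUnion M.children

lemma card_children_le (u : Fin M.size) : (M.children u).card ≤ 2 := by
  classical
  have h : (M.children u).map Function.Embedding.some ⊆ Finset.univ.image (M.ptr u) := by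
    intro o ho
    simp only [children, Finset.mem_map, Finset.mem_filter, Finset.mem_univ, true_and] at ho
    obtain ⟨v, ⟨b, hb⟩, rfl⟩ := ho
    exact Finset.mem_image.2 ⟨b, Finset.mem_univ _, hb⟩
  calc (M.children u).card = ((M.children u).map Function.Embedding.some).card := by simp
    _ ≤ (Finset.univ.image (M.ptr u)).card := Finset.card_le_card h
    _ ≤ (Finset.univ : Finset Bool).card := Finset.card_image_le
    _ = 2 := rfl

lemma card_nearby_le (w : Fin M.size) (g : ℕ) : (M.nearby w g).card ≤ 3 ^ g := by
  induction g with
  | zero => simp [nearby]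
  | succ g ih =>
    have h1 := Finset.card_union_le (M.nearby w g) ((M.nearby w g).biUnion M.children)
    have h2 := Finset.card_biUnion_le_card_mul (M.nearby w g) M.children 2
      fun u _ => M.card_children_le u
    rw [nearby, pow_succ]
    lia

lemma nearby_subset_succ (w : Fin M.size) (g : ℕ) : M.nearby w g ⊆ M.nearby w (g + 1) :=
  Finset.subset_union_left

lemma self_mem_nearby (w : Fin M.size) (g : ℕ) : w ∈ M.nearby w g := by
  induction g with
  | zero => simp [nearby]
  | succ g ih => exact M.nearby_subset_succ w g ih

lemma nearby_mono (w : Fin M.size) : Monotone (M.nearby w) :=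
  monotone_nat_of_le_succ (M.nearby_subset_succ w)

variable {M}

lemma mem_nearby_succ {w u v : Fin M.size} {g : ℕ} {b : Bool} (hu : u ∈ M.nearby w g)
    (h : M.ptr u b = some v) : v ∈ M.nearby w (g + 1) := by
  refine Finset.mem_union_right _ (Finset.mem_biUnion.2 ⟨u, hu, ?_⟩)
  exact Finset.mem_filter.2 ⟨Finset.mem_univ _, b, h⟩

namespace Explores

variable {W : Finset (Fin M.size)} {t : ℕ}

lemma card_le (h : M.Explores W t) : W.card ≤ t + 1 := by
  induction h with
  | start => simp
  | follow b _ _ _ ih => exact (Finset.card_insert_le _ _).trans (by lia)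

lemma subset_nearby_root (h : M.Explores W t) : W ⊆ M.nearby M.root t := by
  induction h with
  | start => simp [nearby]
  | follow b _ hu hv ih =>
    exact Finset.insert_subset (mem_nearby_succ (ih hu) hv) (ih.trans (M.nearby_subset_succ _ _))

/-- Within an explored set, a cell can be reached along at most `g` pointers from the root, or
from at least `g + 1` explored cells. -/
lemma root_or_card_le (h : M.Explores W t) (g : ℕ) {v : Fin M.size} (hv : v ∈ W) :
    v ∈ M.nearby M.root g ∨ g + 1 ≤ (W.filter fun w => v ∈ M.nearby w g).card := by
  induction h generalizing g v with
  | start =>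
    obtain rfl := Finset.mem_singleton.1 hv
    exact Or.inl (M.self_mem_nearby _ _)
  | @follow W t u x b _ hu hx ih =>
    by_cases hxW : x ∈ W
    · rw [Finset.insert_eq_self.2 hxW] at hv ⊢
      exact ih g hv
    · rcases Finset.mem_insert.1 hv with rfl | hv
      · cases g with
        | zero =>
          refine Or.inr (Finset.card_pos.2 ⟨v, ?_⟩)
          simp [nearby]
        | succ g =>
          rcases ih g hu with h | h
          · exact Or.inl (mem_nearby_succ h hx)
          · refine Or.inr ?_
            -- The new cell lies outside the old explored set, so it adds one to the cells counted
            -- for its predecessor `u`.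
            have hv' : v ∉ W.filter fun w => u ∈ M.nearby w g := fun h' =>
              hxW (Finset.mem_of_mem_filter _ h')
            calc g + 1 + 1 ≤ (insert v (W.filter fun w => u ∈ M.nearby w g)).card := by
                  rw [Finset.card_insert_of_notMem hv']; lia
              _ ≤ _ := by
                  refine Finset.card_le_card fun w hw => ?_
                  rcases Finset.mem_insert.1 hw with rfl | hw
                  · simp [self_mem_nearby]
                  · rw [Finset.mem_filter] at hw ⊢
                    exact ⟨Finset.mem_insert_of_mem hw.1, mem_nearby_succ hw.2 hx⟩
      · refine (ih g hv).imp_right fun h => h.trans (Finset.card_le_card ?_)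
        exact Finset.filter_subset_filter _ (Finset.subset_insert _ _)

end Explores

variable (M)

/-- Two distinct elements are close if they are stored in cells that can both be reached from a
common cell along at most `g` pointers. -/
def Close (g : ℕ) (p q : α) : Prop :=
  p ≠ q ∧ ∃ w, (∃ u ∈ M.nearby w g, M.store u = some p) ∧ ∃ v ∈ M.nearby w g, M.store v = some q

/-- A close pair is charged to its common cell `w` and to two of the at most 3^g cells near `w`. -/
lemma card_close_le [Fintype α] (g : ℕ) [DecidablePred fun e : α × α => M.Close g e.1 e.2] :
    (Finset.univ.filter fun e : α × α => M.Close g e.1 e.2).card ≤ M.size * 9 ^ g := by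
  classical
  let F : Finset (Option α × Option α) := Finset.univ.biUnion fun w : Fin M.size =>
    ((M.nearby w g) ×ˢ (M.nearby w g)).image fun e => (M.store e.1, M.store e.2)
  have hF : F.card ≤ M.size * 9 ^ g := by
    have := Finset.card_biUnion_le_card_mul (Finset.univ : Finset (Fin M.size)) (fun w =>
      ((M.nearby w g) ×ˢ (M.nearby w g)).image fun e => (M.store e.1, M.store e.2)) (9 ^ g) ?_
    · simpa using this
    · intro w _
      refine Finset.card_image_le.trans ?_
      rw [Finset.card_product, show (9 : ℕ) = 3 * 3 from rfl, mul_pow]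
      exact Nat.mul_le_mul (M.card_nearby_le w g) (M.card_nearby_le w g)
  refine le_trans ?_ hF
  refine Finset.card_le_card_of_injOn (fun e => (some e.1, some e.2)) ?_ ?_
  · rintro ⟨p, q⟩ h
    obtain ⟨-, w, ⟨u, hu, hu'⟩, v, hv, hv'⟩ := (Finset.mem_filter.1 h).2
    refine Finset.mem_biUnion.2 ⟨w, Finset.mem_univ _, Finset.mem_image.2 ⟨(u, v), ?_, ?_⟩⟩
    · exact Finset.mem_product.2 ⟨hu, hv⟩
    · simp [hu', hv']
  · rintro ⟨p, q⟩ _ ⟨p', q'⟩ _ h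
    simpa using h

variable {M}

/-- Elements reported together that are pairwise not close are few. -/
lemma ReportsWithin.card_le_of_not_close {A : Finset α} {T : ℝ} (h : M.ReportsWithin (A : Set α) T)
    (g : ℕ) (hA : ∀ p ∈ A, ∀ q ∈ A, ¬ M.Close g p q) :
    ((A.card : ℝ) - 1) * (g + 1) ≤ T + 1 := by
  classical
  obtain ⟨W, t, hW, ht, hrep⟩ := h
  have : Nonempty (Fin M.size) := ⟨M.root⟩
  choose! c hcW hc using hrep
  have hdisj : ∀ p ∈ A, ∀ q ∈ A, ∀ w, c p ∈ M.nearby w g → c q ∈ M.nearby w g → p = q := by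
    intro p hp q hq w hpw hqw
    by_contra hpq
    exact hA p hp q hq ⟨hpq, w, ⟨c p, hpw, hc p hp⟩, c q, hqw, hc q hq⟩
  let R := A.filter fun p => c p ∈ M.nearby M.root g
  let R' := A.filter fun p => ¬ c p ∈ M.nearby M.root g
  have hR : R.card ≤ 1 := by
    refine Finset.card_le_one.2 fun p hp q hq => ?_
    rw [Finset.mem_filter] at hp hq
    exact hdisj p hp.1 q hq.1 _ hp.2 hq.2
  have hsum : R.card + R'.card = A.card := Finset.card_filter_add_card_filter_not _
  -- Away from the root, each element claims `g + 1` explored cells, and elements that are not close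
  -- claim disjoint sets.
  have hR' : R'.card * (g + 1) ≤ W.card := by
    calc R'.card * (g + 1) ≤ ∑ p ∈ R', (W.filter fun w => c p ∈ M.nearby w g).card := by
          rw [← smul_eq_mul]
          refine Finset.card_nsmul_le_sum _ _ _ fun p hp => ?_
          rw [Finset.mem_filter] at hp
          exact (hW.root_or_card_le g (hcW p hp.1)).resolve_left hp.2
      _ = (R'.biUnion fun p => W.filter fun w => c p ∈ M.nearby w g).card := by
          refine (Finset.card_biUnion fun p hp q hq hpq => ?_).symm
          rw [Function.onFun, Finset.disjoint_left]
          intro w hw hw'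
          exact hpq (hdisj p (Finset.mem_of_mem_filter p hp) q (Finset.mem_of_mem_filter q hq) w
            (Finset.mem_filter.1 hw).2 (Finset.mem_filter.1 hw').2)
      _ ≤ W.card := Finset.card_le_card (Finset.biUnion_subset.2 fun p _ =>
          Finset.filter_subset _ _)
  have h1 : (A.card - 1 : ℝ) ≤ R'.card := by
    have : A.card ≤ R'.card + 1 := by lia
    have : (A.card : ℝ) ≤ R'.card + 1 := by exact_mod_cast this
    linarith
  have h2 : (R'.card * (g + 1) : ℝ) ≤ t + 1 := by exact_mod_cast hR'.trans hW.card_le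
  calc ((A.card : ℝ) - 1) * (g + 1) ≤ R'.card * (g + 1) := by gcongr
    _ ≤ T + 1 := by linarith

lemma Close.symm {g : ℕ} {p q : α} (h : M.Close g p q) : M.Close g q p := by
  obtain ⟨hne, w, h1, h2⟩ := h
  exact ⟨hne.symm, w, h2, h1⟩

/-- A quickly reported set contains many close pairs. -/
lemma ReportsWithin.card_le_card_close {A : Finset α} {T B : ℝ}
    (h : M.ReportsWithin (A : Set α) T) (hT : T + 1 ≤ B * A.card) (hA : 2 ≤ A.card) {g : ℕ}
    (hg : 4 * B ≤ g + 1) [DecidablePred fun e : α × α => M.Close g e.1 e.2] :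
    A.card ≤ 4 * ((A ×ˢ A).filter fun e => M.Close g e.1 e.2).card := by
  classical
  let Indep : Finset α → Prop := fun I => ∀ p ∈ I, ∀ q ∈ I, ¬ M.Close g p q
  -- A largest set without close pairs is small by the previous bound, and by maximality every
  -- element outside it is close to one inside.
  obtain ⟨I, hI, hmax⟩ := Finset.exists_max_image (A.powerset.filter Indep) Finset.card
    ⟨∅, by simp [Indep]⟩
  rw [Finset.mem_filter, Finset.mem_powerset] at hI
  obtain ⟨hIA, hI⟩ := hI
  have hrep : M.ReportsWithin (I : Set α) T := by
    obtain ⟨W, t, hW, ht, h⟩ := h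
    exact ⟨W, t, hW, ht, fun p hp => h p (hIA hp)⟩
  have h1 := hrep.card_le_of_not_close g hI
  have hIcard : (4 * (I.card - 1) : ℝ) ≤ A.card := by
    by_contra! hlt
    have hgpos : (0 : ℝ) < g + 1 := by positivity
    nlinarith [mul_le_mul_of_nonneg_right hg (Nat.cast_nonneg (α := ℝ) A.card)]
  have hIcard' : 4 * I.card ≤ A.card + 4 := by
    have : (4 * I.card : ℝ) ≤ A.card + 4 := by linarith
    exact_mod_cast this
  have hout : (A \ I).card ≤ ((A ×ˢ A).filter fun e => M.Close g e.1 e.2).card := by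
    have hex : ∀ p ∈ A \ I, ∃ q ∈ I, M.Close g p q := by
      intro p hp
      rw [Finset.mem_sdiff] at hp
      by_contra! hno
      have := hmax (insert p I) ?_
      · rw [Finset.card_insert_of_notMem hp.2] at this
        lia
      · rw [Finset.mem_filter, Finset.mem_powerset]
        refine ⟨Finset.insert_subset hp.1 hIA, fun x hx y hy hxy => ?_⟩
        rcases Finset.mem_insert.1 hx with rfl | hx <;> rcases Finset.mem_insert.1 hy with rfl | hy
        · exact hxy.1 rfl
        · exact hno y hy hxy
        · exact hno x (by assumption) hxy.symm
        · exact hI x hx y hy hxy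
    choose! f hfI hf using hex
    refine Finset.card_le_card_of_injOn (fun p => (p, f p)) (fun p hp => ?_) ?_
    · have hp' := Finset.mem_coe.1 hp
      exact Finset.mem_filter.2 ⟨Finset.mem_product.2 ⟨(Finset.mem_sdiff.1 hp').1,
        hIA (hfI p hp')⟩, hf p hp'⟩
    · intro p _ q _ hpq
      exact congrArg Prod.fst hpq
  have h3 := Finset.card_sdiff_add_card_eq_card hIA
  -- 4|A \ I| ≥ 3|A| - 4 ≥ |A|, since |A| ≥ 2.
  lia

/-- The pointer machine lower bound: if sets of at least two elements are reported within time
proportional to their size, and any two elements lie together in at most `m` of the sets, then the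
number of cells is at least proportional to the total size of the sets. -/
lemma sum_card_le_size [Fintype α] {ι : Type*} (J : Finset ι) (A : ι → Finset α) (T : ι → ℝ)
    {B : ℝ} {g m : ℕ} (hrep : ∀ j ∈ J, M.ReportsWithin (A j : Set α) (T j))
    (hT : ∀ j ∈ J, T j + 1 ≤ B * (A j).card) (hA : ∀ j ∈ J, 2 ≤ (A j).card)
    (hg : 4 * B ≤ g + 1)
    (hm : ∀ p q : α, p ≠ q → {j | j ∈ J ∧ p ∈ A j ∧ q ∈ A j}.ncard ≤ m) :
    ∑ j ∈ J, (A j).card ≤ 4 * m * (M.size * 9 ^ g) := by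
  classical
  let E := Finset.univ.filter fun e : α × α => M.Close g e.1 e.2
  have h1 : ∑ j ∈ J, (A j).card ≤
      ∑ j ∈ J, 4 * (E.filter fun e => e.1 ∈ A j ∧ e.2 ∈ A j).card := by
    refine Finset.sum_le_sum fun j hj => ?_
    refine ((hrep j hj).card_le_card_close (hT j hj) (hA j hj) hg).trans ?_
    refine Nat.mul_le_mul_left _ (Finset.card_le_card fun e he => ?_)
    rw [Finset.mem_filter, Finset.mem_product] at he
    exact Finset.mem_filter.2 ⟨Finset.mem_filter.2 ⟨Finset.mem_univ _, he.2⟩, he.1⟩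
  have h2 : ∑ j ∈ J, (E.filter fun e => e.1 ∈ A j ∧ e.2 ∈ A j).card ≤ E.card * m := by
    have h3 := Finset.sum_card_bipartiteAbove_eq_sum_card_bipartiteBelow (s := J) (t := E)
      (fun j e => e.1 ∈ A j ∧ e.2 ∈ A j)
    refine h3.le.trans (Finset.sum_le_card_nsmul _ _ _ fun e he => ?_)
    refine le_trans (le_of_eq ?_) (hm e.1 e.2 (Finset.mem_filter.1 he).2.1)
    rw [← Set.ncard_coe_finset]
    simp [Finset.bipartiteBelow]
  rw [← Finset.mul_sum] at h1
  have h3 := M.card_close_le g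
  calc ∑ j ∈ J, (A j).card ≤ 4 * (E.card * m) := h1.trans (Nat.mul_le_mul_left _ h2)
    _ ≤ 4 * (M.size * 9 ^ g * m) := by gcongr
    _ = _ := by ring

end PointerStructure

/-! ### Small normals from the moment curve modulo p -/

/-- Simultaneous approximation modulo `p`: some nonzero multiple of any vector over `ZMod p` has
small integer representatives. -/
lemma ZMod.exists_small_multiple {p : ℕ} [Fact p.Prime] {d q : ℕ} (hq : q ^ d < p)
    (v : Fin d → ZMod p) :
    ∃ t : ZMod p, t ≠ 0 ∧ ∃ a : Fin d → ℤ, (∀ i, (a i : ZMod p) = t * v i) ∧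
      ∀ i, |a i| * q < p := by
  have hp : 0 < p := (Fact.out : p.Prime).pos
  have hp' : p ≠ 0 := hp.ne'
  have hcard : Fintype.card (Fin d → Fin q) < Fintype.card (ZMod p) := by
    simpa [ZMod.card] using hq
  have hidx : ∀ z : ZMod p, 0 < q → z.val * q / p < q := fun z h0 => by
    rw [Nat.div_lt_iff_lt_mul hp, mul_comm]
    exact Nat.mul_lt_mul_of_pos_left z.val_lt h0
  rcases Nat.eq_zero_or_pos q with rfl | h0
  · refine ⟨1, one_ne_zero, fun i => (v i).val, fun i => by simp, fun i => by simpa using hp⟩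
  -- Dirichlet's pigeonhole: p multiples fall into q^d < p boxes of side p/q, and two in the same
  -- box are subtracted.
  obtain ⟨s, t, hst, h⟩ := Fintype.exists_ne_map_eq_of_card_lt
    (fun s : ZMod p => fun i : Fin d => (⟨(s * v i).val * q / p, hidx _ h0⟩ : Fin q)) hcard
  refine ⟨s - t, sub_ne_zero.2 hst, fun i => (s * v i).val - (t * v i).val, fun i => ?_,
    fun i => ?_⟩
  · simp [sub_mul]
  · have hi : (s * v i).val * q / p = (t * v i).val * q / p := by
      simpa using congrArg Fin.val (congrFun h i)
    have h1 := Nat.div_add_mod ((s * v i).val * q) p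
    have h2 := Nat.div_add_mod ((t * v i).val * q) p
    have h3 := Nat.mod_lt ((s * v i).val * q) hp
    have h4 := Nat.mod_lt ((t * v i).val * q) hp
    rw [hi] at h1
    zify at h1 h2 h3 h4
    have h5 := Int.emod_nonneg ((s * v i).val * q : ℤ) (Int.natCast_ne_zero.2 hp')
    have h6 := Int.emod_nonneg ((t * v i).val * q : ℤ) (Int.natCast_ne_zero.2 hp')
    have h7 : |((s * v i).val : ℤ) - (t * v i).val| * q =
        |((s * v i).val * q : ℤ) - (t * v i).val * q| := by
      rw [← sub_mul, abs_mul, abs_of_nonneg (Int.natCast_nonneg q)]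
    rw [h7, abs_lt]
    constructor <;> linarith

/-- Small integer vectors, one for each residue `x`, such that a nonzero integer vector is
orthogonal to fewer than `d` of them. -/
lemma exists_vectors_in_general_position {p : ℕ} [Fact p.Prime] {d q : ℕ} (hd : 0 < d)
    (hq : q ^ d < p) :
    ∃ a : ZMod p → Fin d → ℤ, (∀ x i, |a x i| * q < p) ∧ (∀ x, a x ≠ 0) ∧
      ∀ w : Fin d → ℤ, w ≠ 0 → {x | a x ⬝ᵥ w = 0}.ncard ≤ d - 1 := by
  classical
  choose t ht a ha hsmall using fun x : ZMod p =>
    ZMod.exists_small_multiple hq fun i : Fin d => x ^ (i : ℕ)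
  refine ⟨a, hsmall, fun x hx => ht x ?_, fun w hw => ?_⟩
  · simpa [hx] using (ha x ⟨0, hd⟩).symm
  obtain ⟨i₀, hi₀⟩ := Function.ne_iff.1 hw
  -- A nonzero `w` may vanish modulo p; its primitive part `u` cannot, so the polynomial with
  -- coefficients `u` is nonzero.
  obtain ⟨u, hu, hgcd⟩ := Finset.extract_gcd w (s := Finset.univ) ⟨i₀, Finset.mem_univ _⟩
  set g := Finset.univ.gcd w
  have hg : g ≠ 0 := fun h => hi₀ (by simp [hu i₀ (Finset.mem_univ _), h])
  obtain ⟨j, hj⟩ : ∃ j, ((u j : ℤ) : ZMod p) ≠ 0 := by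
    by_contra! hall
    have : (p : ℤ) ∣ Finset.univ.gcd u := Finset.dvd_gcd fun i _ =>
      (ZMod.intCast_zmod_eq_zero_iff_dvd _ _).1 (hall i)
    rw [hgcd] at this
    have := Int.eq_one_of_dvd_one (Int.natCast_nonneg p) this
    exact (Fact.out : p.Prime).one_lt.ne' (by exact_mod_cast this)
  let f : Polynomial (ZMod p) := ∑ i : Fin d, Polynomial.monomial (i : ℕ) ((u i : ℤ) : ZMod p)
  have hcoeff : f.coeff j = ((u j : ℤ) : ZMod p) := by
    simp [f, Polynomial.coeff_monomial, Fin.val_inj]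
  have hf : f ≠ 0 := fun h => hj (by rw [← hcoeff, h, Polynomial.coeff_zero])
  have hdeg : f.natDegree ≤ d - 1 := Polynomial.natDegree_sum_le_of_forall_le _ _ fun i _ =>
    (Polynomial.natDegree_monomial_le _).trans (by lia)
  have hsub : {x | a x ⬝ᵥ w = 0} ⊆ (f.roots.toFinset : Set (ZMod p)) := by
    intro x hx
    have h1 : g * (a x ⬝ᵥ u) = 0 := by
      rw [← hx.out, dotProduct, dotProduct, Finset.mul_sum]
      refine Finset.sum_congr rfl fun i hi => ?_
      rw [hu i hi]
      ring
    have h2 := (mul_eq_zero.1 h1).resolve_left hg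
    have h3 : t x * f.eval x = 0 := by
      have := congrArg (Int.cast : ℤ → ZMod p) h2
      simp only [dotProduct, Int.cast_sum, Int.cast_mul, ha, Int.cast_zero] at this
      rw [← this, Polynomial.eval_finsetSum, Finset.mul_sum]
      refine Finset.sum_congr rfl fun i _ => ?_
      rw [Polynomial.eval_monomial]
      ring
    simpa [hf] using (mul_eq_zero.1 h3).resolve_left (ht x)
  calc {x | a x ⬝ᵥ w = 0}.ncard ≤ (f.roots.toFinset : Set (ZMod p)).ncard :=
        Set.ncard_le_ncard hsub (Finset.finite_toSet _)
    _ = f.roots.toFinset.card := Set.ncard_coe_finset _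
    _ ≤ f.roots.card := Multiset.toFinset_card_le _
    _ ≤ d - 1 := (Polynomial.card_roots' f).trans hdeg

/-! ### Simplices that isolate points or cut out hyperplanes -/

section

open Filter Topology

variable {d : ℕ}

lemma simplexRegion_map (Δ : Affine.Simplex ℝ (EuclideanSpace ℝ (Fin d)) d)
    (f : EuclideanSpace ℝ (Fin d) →ᵃ[ℝ] EuclideanSpace ℝ (Fin d)) (hf : Function.Injective f) :
    simplexRegion (Δ.map f hf) = f '' simplexRegion Δ := by
  rw [simplexRegion, simplexRegion, AffineMap.image_convexHull, ← Set.range_comp]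
  rfl

/-- Query simplices are affine images of this one: the inner ball shows what an image contains, the
outer ball what it misses. -/
lemma exists_simplexRegion_between_balls (d : ℕ) :
    ∃ (Δ : Affine.Simplex ℝ (EuclideanSpace ℝ (Fin d)) d) (ρ : ℝ), 0 < ρ ∧
      Metric.ball 0 ρ ⊆ simplexRegion Δ ∧ simplexRegion Δ ⊆ Metric.ball 0 1 := by
  obtain ⟨b, hb, hb'⟩ := exists_mem_interior_convexHull_affineBasis
    (Metric.ball_mem_nhds (0 : EuclideanSpace ℝ (Fin d)) one_pos)
  have e : Fin (Module.finrank ℝ (EuclideanSpace ℝ (Fin d)) + 1) ≃ Fin (d + 1) :=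
    finCongr (by simp)
  have hrange : Set.range (b.reindex e) = Set.range b := by
    rw [AffineBasis.coe_reindex, Set.range_comp, e.symm.range_eq_univ, Set.image_univ]
  obtain ⟨ρ, hρ, h⟩ := Metric.mem_nhds_iff.1 (mem_interior_iff_mem_nhds.1 hb)
  refine ⟨⟨b.reindex e, (b.reindex e).ind⟩, ρ, hρ, ?_, ?_⟩
  · rwa [simplexRegion, hrange]
  · rwa [simplexRegion, hrange]

/-- A sufficiently small simplex isolates a given point from a finite set. -/
lemma exists_simplex_isolating (P : Finset (EuclideanSpace ℝ (Fin d)))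
    (p : EuclideanSpace ℝ (Fin d)) :
    ∃ γ : Affine.Simplex ℝ (EuclideanSpace ℝ (Fin d)) d,
      p ∈ simplexRegion γ ∧ ∀ x ∈ P, x ∈ simplexRegion γ → x = p := by
  obtain ⟨Δ, ρ, hρ, hin, hout⟩ := exists_simplexRegion_between_balls d
  have hev : ∀ᶠ ε : ℝ in 𝓝[>] 0, ∀ x ∈ P, x = p ∨ ε < ‖x - p‖ := by
    refine (eventually_all_finset P).2 fun x _ => ?_
    by_cases hx : x = p
    · exact Eventually.of_forall fun _ => Or.inl hx
    · filter_upwards [Ioo_mem_nhdsGT (norm_pos_iff.2 (sub_ne_zero.2 hx))] with ε hε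
      exact Or.inr hε.2
  obtain ⟨ε, hε, hε0⟩ := (hev.and self_mem_nhdsWithin).exists
  replace hε0 : 0 < ε := hε0
  let f : EuclideanSpace ℝ (Fin d) →ᵃ[ℝ] EuclideanSpace ℝ (Fin d) :=
    (ε • LinearMap.id).toAffineMap + AffineMap.const ℝ _ p
  have hfy : ∀ y, f y = ε • y + p := fun y => rfl
  have hf : Function.Injective f := fun y z h => by
    rw [hfy, hfy] at h
    exact smul_right_injective _ hε0.ne' (add_right_cancel h)
  refine ⟨Δ.map f hf, ?_, fun x hx hxγ => (hε x hx).resolve_right ?_⟩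
  · rw [simplexRegion_map]
    exact ⟨0, hin (Metric.mem_ball_self hρ), by simp [hfy]⟩
  · rw [simplexRegion_map] at hxγ
    obtain ⟨y, hy, rfl⟩ := hxγ
    have hy1 := mem_ball_zero_iff.1 (hout hy)
    rw [hfy, add_sub_cancel_right, norm_smul, Real.norm_of_nonneg hε0.le]
    nlinarith

/-- A sufficiently large and thin simplex cuts out of a finite set the points of a hyperplane. -/
lemma exists_simplex_cutting_hyperplane (P : Finset (EuclideanSpace ℝ (Fin d)))
    {v : EuclideanSpace ℝ (Fin d)} (hv : v ≠ 0) (b : ℝ) :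
    ∃ γ : Affine.Simplex ℝ (EuclideanSpace ℝ (Fin d)) d,
      ∀ x ∈ P, x ∈ simplexRegion γ ↔ inner ℝ v x = b := by
  obtain ⟨Δ, ρ, hρ, hin, hout⟩ := exists_simplexRegion_between_balls d
  have hv2 : inner ℝ v v ≠ 0 := inner_self_ne_zero.2 hv
  set p : EuclideanSpace ℝ (Fin d) := (b / inner ℝ v v) • v
  have hp : inner ℝ v p = b := by
    rw [inner_smul_right, div_mul_cancel₀ _ hv2]
  have hthin : ∀ᶠ ε : ℝ in 𝓝[>] 0, ∀ x ∈ P, inner ℝ v x = b ∨ ε * ‖v‖ < |inner ℝ v x - b| := by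
    refine (eventually_all_finset P).2 fun x _ => ?_
    by_cases hx : inner ℝ v x = b
    · exact Eventually.of_forall fun _ => Or.inl hx
    · have hpos : 0 < |inner ℝ v x - b| / ‖v‖ :=
        div_pos (abs_pos.2 (sub_ne_zero.2 hx)) (norm_pos_iff.2 hv)
      filter_upwards [Ioo_mem_nhdsGT hpos] with ε hε
      exact Or.inr ((lt_div_iff₀ (norm_pos_iff.2 hv)).1 hε.2)
  have hlarge : ∀ᶠ R : ℝ in atTop, ∀ x ∈ P, ‖x - p‖ < R * ρ := by
    refine (eventually_all_finset P).2 fun x _ => ?_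
    filter_upwards [eventually_gt_atTop (‖x - p‖ / ρ)] with R hR
    exact (div_lt_iff₀ hρ).1 hR
  obtain ⟨ε, hε, hε0⟩ := (hthin.and self_mem_nhdsWithin).exists
  obtain ⟨R, hR, hR0⟩ := (hlarge.and (eventually_gt_atTop 0)).exists
  replace hε0 : 0 < ε := hε0
  -- Scaling by ε along `v` and by R orthogonally to it, centred at the point `p` of the hyperplane.
  let f : EuclideanSpace ℝ (Fin d) →ᵃ[ℝ] EuclideanSpace ℝ (Fin d) :=
    (R • LinearMap.id + ((ε - R) / inner ℝ v v) • (innerₗ _ v).smulRight v).toAffineMap +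
      AffineMap.const ℝ _ p
  have hfy : ∀ y, f y = R • y + ((ε - R) / inner ℝ v v) • (inner ℝ v y • v) + p := fun y => rfl
  have hinner : ∀ y, inner ℝ v (f y) = ε * inner ℝ v y + b := fun y => by
    rw [hfy, inner_add_right, inner_add_right, inner_smul_right, inner_smul_right,
      inner_smul_right, hp]
    field_simp
    ring
  have hf : Function.Injective f := fun y z h => by
    have h1 : inner ℝ v y = inner ℝ v z := by
      have := congrArg (inner ℝ v) h
      rw [hinner, hinner] at this
      exact mul_left_cancel₀ hε0.ne' (add_right_cancel this)
    rw [hfy, hfy, h1] at h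
    exact smul_right_injective _ hR0.ne' (add_right_cancel (add_right_cancel h))
  refine ⟨Δ.map f hf, fun x hx => ?_⟩
  rw [simplexRegion_map]
  constructor
  · rintro ⟨y, hy, rfl⟩
    refine (hε _ hx).resolve_right ?_
    have hy1 := mem_ball_zero_iff.1 (hout hy)
    rw [hinner, add_sub_cancel_right, abs_mul, abs_of_pos hε0, not_lt]
    have := abs_real_inner_le_norm v y
    have := norm_nonneg v
    gcongr
    nlinarith
  · intro hxb
    refine ⟨R⁻¹ • (x - p), hin (mem_ball_zero_iff.2 ?_), ?_⟩
    · rw [norm_smul, norm_inv, Real.norm_of_nonneg hR0.le, inv_mul_lt_iff₀ hR0]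
      exact hR x hx
    · rw [hfy, inner_smul_right, inner_sub_right, hxb, hp, smul_inv_smul₀ hR0.ne']
      simp

end

/-! ### Rich hyperplanes in the grid -/

open Finset in
/-- The fibres of at least `h` elements cover all but `h` elements per possible value. -/
lemma Finset.card_sub_le_sum_card_large_fiber {α β : Type*} [DecidableEq β] (s : Finset α)
    (T : Finset β) (f : α → β) (hf : ∀ z ∈ s, f z ∈ T) {h : ℝ} (h0 : 0 ≤ h) :
    (#s : ℝ) - #T * h ≤ ∑ b ∈ T with h ≤ #{z ∈ s | f z = b}, (#{z ∈ s | f z = b} : ℝ) := by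
  have h1 : (#s : ℝ) = ∑ b ∈ T, (#{z ∈ s | f z = b} : ℝ) := by
    exact_mod_cast card_eq_sum_card_fiberwise hf
  have h2 : ∑ b ∈ T with ¬ h ≤ #{z ∈ s | f z = b}, (#{z ∈ s | f z = b} : ℝ) ≤ #T * h := by
    calc ∑ b ∈ T with ¬ h ≤ #{z ∈ s | f z = b}, (#{z ∈ s | f z = b} : ℝ)
        ≤ #{b ∈ T | ¬ h ≤ #{z ∈ s | f z = b}} • h :=
          sum_le_card_nsmul _ _ _ fun b hb => (not_le.1 (mem_filter.1 hb).2).le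
      _ ≤ #T * h := by
          rw [nsmul_eq_mul]
          gcongr
          exact filter_subset _ _
  rw [h1, ← sum_filter_add_sum_filter_not T fun b => h ≤ #{z ∈ s | f z = b}]
  linarith

section

variable {d : ℕ}

/-- An integer vector as a point of Euclidean space. -/
def latticePoint (z : Fin d → ℤ) : EuclideanSpace ℝ (Fin d) :=
  WithLp.toLp 2 fun i => (z i : ℝ)

lemma latticePoint_injective : Function.Injective (latticePoint (d := d)) := fun z w h => by
  funext i
  have := congrArg (fun x : EuclideanSpace ℝ (Fin d) => x i) h
  exact Int.cast_injective (α := ℝ) this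

lemma inner_latticePoint (a z : Fin d → ℤ) :
    inner ℝ (latticePoint a) (latticePoint z) = ((a ⬝ᵥ z : ℤ) : ℝ) := by
  simp [latticePoint, PiLp.inner_apply, dotProduct, mul_comm]

lemma latticePoint_ne_zero {a : Fin d → ℤ} (ha : a ≠ 0) : latticePoint a ≠ 0 := fun h =>
  ha (latticePoint_injective (h.trans (by ext; simp [latticePoint])))

lemma exists_finset_in_grid {n M : ℕ} (h : n ≤ M ^ d) :
    ∃ G : Finset (Fin d → ℤ), G.card = n ∧ ∀ z ∈ G, ∀ i, 0 ≤ z i ∧ z i ≤ M := by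
  have hcard : (Fintype.piFinset fun _ : Fin d => Finset.Ico (0 : ℤ) M).card = M ^ d := by
    simp [Fintype.card_piFinset]
  obtain ⟨G, hG, hn⟩ := Finset.exists_subset_card_eq (h.trans hcard.ge)
  refine ⟨G, hn, fun z hz i => ?_⟩
  have := Finset.mem_Ico.1 (Fintype.mem_piFinset.1 (hG hz) i)
  exact ⟨this.1, this.2.le⟩

lemma abs_dotProduct_le {a z : Fin d → ℤ} {p q M : ℕ} (hq : 0 < q) (ha : ∀ i, |a i| * q < p)
    (hz : ∀ i, 0 ≤ z i ∧ z i ≤ M) : |a ⬝ᵥ z| ≤ (d * p * M / q : ℕ) := by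
  have h1 : |a ⬝ᵥ z| * q ≤ (d * p * M : ℕ) := by
    calc |a ⬝ᵥ z| * q ≤ (∑ i, |a i * z i|) * q := by
          gcongr
          exact Finset.abs_sum_le_sum_abs _ _
      _ = ∑ i, (|a i| * q) * z i := by
          rw [Finset.sum_mul]
          refine Finset.sum_congr rfl fun i _ => ?_
          rw [abs_mul, abs_of_nonneg (hz i).1]
          ring
      _ ≤ ∑ _i : Fin d, (p : ℤ) * M := by
          refine Finset.sum_le_sum fun i _ => ?_
          exact mul_le_mul (ha i).le (hz i).2 (hz i).1 (Int.natCast_nonneg _)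
      _ = (d * p * M : ℕ) := by simp [mul_assoc]
  rw [Int.abs_eq_natAbs] at h1 ⊢
  exact_mod_cast (Nat.le_div_iff_mul_le hq).2 (by exact_mod_cast h1)

namespace SolvesSimplexReporting

/-- The space lower bound given by integer points and hyperplanes with small integer normals. -/
lemma mul_le_size {n : ℕ} {S Q C : ℝ} (hS : SolvesSimplexReporting d n S Q C) (hd : 0 < d)
    {p q M : ℕ} (hp : p.Prime) (hq0 : 0 < q) (hq : q ^ d < p) (hM : n ≤ M ^ d)
    {h : ℝ} (hQ : Q ≤ h) (h2 : 2 ≤ h) (hn : 2 * ((2 * (d * p * M / q : ℕ) + 1) * h) ≤ n)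
    {g : ℕ} (hg : 4 * (C + 2) ≤ g + 1) :
    (p : ℝ) * n ≤ 8 * (d - 1 : ℕ) * 9 ^ g * S := by
  classical
  have : Fact p.Prime := ⟨hp⟩
  obtain ⟨G, rfl, hG⟩ := exists_finset_in_grid hM
  obtain ⟨a, ha, ha0, hgen⟩ := exists_vectors_in_general_position hd hq
  let P := G.map ⟨latticePoint, latticePoint_injective⟩
  obtain ⟨D, hD, hrep⟩ := hS P (Finset.card_map _)
  have hex : ∀ z : P, ∃ w ∈ G, latticePoint w = z := fun z => by
    simpa [P] using Finset.mem_map.1 z.2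
  choose c hcG hc using hex
  have hcinj : ∀ y z, c y = c z → y = z := fun y z h => by
    rw [Subtype.ext_iff, ← hc y, ← hc z, h]
  set l : ℕ := d * p * M / q
  let V : Finset ℤ := Finset.Icc (-l : ℤ) l
  have hV : (V.card : ℝ) = 2 * l + 1 := by
    have : V.card = 2 * l + 1 := by simp only [V, Int.card_Icc]; lia
    exact_mod_cast this
  have hval : ∀ x z, a x ⬝ᵥ c z ∈ V := fun x z =>
    Finset.mem_Icc.2 (abs_le.1 (abs_dotProduct_le hq0 (ha x) (hG _ (hcG z))))
  let A : ZMod p × ℤ → Finset P := fun j => Finset.univ.filter fun z => a j.1 ⬝ᵥ c z = j.2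
  let J : Finset (ZMod p × ℤ) := (Finset.univ ×ˢ V).filter fun j => h ≤ (A j).card
  have hJ : ∀ j ∈ J, h ≤ (A j).card := fun j hj => (Finset.mem_filter.1 hj).2
  have hreport : ∀ j, D.ReportsWithin (A j : Set P) (Q + C * (A j).card) := by
    intro j
    obtain ⟨γ, hγ⟩ := exists_simplex_cutting_hyperplane P (latticePoint_ne_zero (ha0 j.1)) j.2
    have hset : {z : P | (z : EuclideanSpace ℝ (Fin d)) ∈ simplexRegion γ} = (A j : Set P) := by
      ext z
      rw [Set.mem_ofPred_eq, hγ z z.2, ← hc z, inner_latticePoint, Int.cast_inj]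
      simp [A]
    have := hrep γ
    rwa [hset, Set.ncard_coe_finset] at this
  -- `B = C + 2` works because Q ≤ h ≤ |A j| and 1 ≤ |A j|. For `m = d - 1`: the normal must be
  -- orthogonal to the difference of the two points, and it then determines the hyperplane.
  have hupper := D.sum_card_le_size J A (fun j => Q + C * (A j).card) (B := C + 2) (g := g)
    (m := d - 1) (fun j _ => hreport j) (fun j hj => by have := hJ j hj; linarith)
    (fun j hj => by exact_mod_cast h2.trans (hJ j hj)) hg (fun y z hyz => by
      refine le_trans ?_ (hgen (c y - c z) (sub_ne_zero.2 fun h => hyz (hcinj _ _ h)))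
      refine Set.ncard_le_ncard_of_injOn Prod.fst ?_ ?_ (Set.toFinite _)
      · rintro j ⟨-, hy, hz⟩
        rw [Set.mem_ofPred_eq, dotProduct_sub, (Finset.mem_filter.1 hy).2,
          (Finset.mem_filter.1 hz).2, sub_self]
      · rintro ⟨x, b⟩ ⟨-, hy, -⟩ ⟨x', b'⟩ ⟨-, hy', -⟩ (rfl : x = x')
        rw [Prod.mk.injEq]
        exact ⟨rfl, (Finset.mem_filter.1 hy).2.symm.trans (Finset.mem_filter.1 hy').2⟩)
  have hlower : (p : ℝ) * G.card ≤ 2 * ∑ j ∈ J, ((A j).card : ℝ) := by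
    -- By `hn`, hyperplanes with fewer than h points lose at most half of the grid points for each
    -- normal.
    have hx : ∀ x : ZMod p, (G.card : ℝ) / 2 ≤
        ∑ b ∈ V, if h ≤ (A (x, b)).card then ((A (x, b)).card : ℝ) else 0 := fun x => by
      have := Finset.card_sub_le_sum_card_large_fiber (Finset.univ : Finset P) V
        (fun z => a x ⬝ᵥ c z) (fun z _ => hval x z) (zero_le_two.trans h2)
      rw [Finset.sum_filter] at this
      refine le_trans ?_ this
      rw [hV, Finset.card_univ, Fintype.card_coe, Finset.card_map]
      linarith
    have := Finset.card_nsmul_le_sum (Finset.univ : Finset (ZMod p)) _ _ fun x _ => hx x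
    rw [Finset.card_univ, ZMod.card, nsmul_eq_mul] at this
    rw [Finset.sum_filter, Finset.sum_product]
    linarith
  have hupper' : ∑ j ∈ J, ((A j).card : ℝ) ≤ 4 * (d - 1 : ℕ) * (D.size * 9 ^ g) := by
    exact_mod_cast hupper
  calc (p : ℝ) * G.card ≤ 2 * (4 * (d - 1 : ℕ) * (D.size * 9 ^ g)) := by linarith
    _ = 8 * (d - 1 : ℕ) * 9 ^ g * D.size := by ring
    _ ≤ _ := by gcongr

/-- Reporting single points takes linear space, and time logarithmic in their number. -/
lemma card_le {n : ℕ} {S Q C : ℝ} (hS : SolvesSimplexReporting d n S Q C) (hd : 0 < d) :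
    (n : ℝ) ≤ S ∧ n ≤ 3 ^ ⌊Q + C⌋₊ := by
  obtain ⟨G, hn, -⟩ := exists_finset_in_grid (Nat.le_self_pow hd.ne' n)
  let P := G.map ⟨latticePoint, latticePoint_injective⟩
  have hP : P.card = n := by rw [Finset.card_map, hn]
  obtain ⟨D, hD, hrep⟩ := hS P hP
  have hex : ∀ z : P, ∃ v ∈ D.nearby D.root ⌊Q + C⌋₊, D.store v = some z := fun z => by
    obtain ⟨γ, hz, hγ⟩ := exists_simplex_isolating P (z : EuclideanSpace ℝ (Fin d))
    have hset : {y : P | (y : EuclideanSpace ℝ (Fin d)) ∈ simplexRegion γ} = {z} := by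
      ext y
      rw [Set.mem_ofPred_eq, Set.mem_singleton_iff, Subtype.ext_iff]
      exact ⟨hγ y y.2, fun h => h ▸ hz⟩
    have := hrep γ
    rw [hset, Set.ncard_singleton, Nat.cast_one, mul_one] at this
    obtain ⟨W, t, hW, ht, hstore⟩ := this
    obtain ⟨v, hv, hvz⟩ := hstore z rfl
    exact ⟨v, D.nearby_mono _ (Nat.le_floor ht) (hW.subset_nearby_root hv), hvz⟩
  choose f hf hfs using hex
  have hinj : Function.Injective f := fun y z h => by
    have := hfs y
    rw [h, hfs z] at this
    exact (Option.some_injective _ this).symm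
  constructor
  · have := Fintype.card_le_of_injective f hinj
    rw [Fintype.card_coe, hP, Fintype.card_fin] at this
    exact le_trans (by exact_mod_cast this) hD
  · have := Finset.card_le_card_of_injOn f (s := Finset.univ) (fun z _ => hf z) hinj.injOn
    rw [Finset.card_univ, Fintype.card_coe, hP] at this
    exact this.trans (D.card_nearby_le _ _)

end SolvesSimplexReporting

end

/-! ### Choice of parameters -/

lemma Nat.exists_pow_lt_le_two_mul_pow {d m : ℕ} (hd : d ≠ 0) (hm : 2 ≤ m) :
    ∃ q, 0 < q ∧ q ^ d < m ∧ m ≤ (2 * q) ^ d := by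
  classical
  have hex : ∃ q, m ≤ q ^ d := ⟨m, Nat.le_self_pow hd m⟩
  obtain ⟨q, hq⟩ : ∃ q, Nat.find hex = q + 1 := Nat.exists_eq_succ_of_ne_zero fun h => by
    have := Nat.find_spec hex
    rw [h, zero_pow hd] at this
    lia
  have hspec := Nat.find_spec hex
  rw [hq] at hspec
  have h0 : 0 < q := Nat.pos_of_ne_zero fun h => by
    rw [h, zero_add, one_pow] at hspec
    lia
  exact ⟨q, h0, not_le.1 (Nat.find_min hex (by lia)),
    hspec.trans (Nat.pow_le_pow_left (by lia) d)⟩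

lemma SolvesSimplexReporting.le_query_time {d : ℕ} (hd : 2 ≤ d) (C : ℝ) :
    ∃ c : ℝ, 0 < c ∧ ∃ n₀ : ℕ, ∀ (n : ℕ) (S Q : ℝ), n₀ ≤ n → SolvesSimplexReporting d n S Q C →
      0 < (n : ℝ) ∧ 0 < S ∧ c * ((n : ℝ) ^ 2 / S) ^ (((d : ℝ) - 1) / d) ≤ Q := by
  obtain ⟨g, hg⟩ := exists_nat_ge (4 * (C + 2))
  -- One more than the constant of `mul_le_size`, so that pn > KS contradicts it.
  set K : ℝ := 8 * (d - 1 : ℕ) * 9 ^ g + 1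
  have hK : 1 ≤ K := by
    have : (0 : ℝ) ≤ 8 * (d - 1 : ℕ) * 9 ^ g := by positivity
    linarith
  have hd0 : (0 : ℝ) < d := by exact_mod_cast (by lia : 0 < d)
  have hd2 : (2 : ℝ) ≤ d := by exact_mod_cast hd
  set e : ℝ := ((d : ℝ) - 1) / d
  have he0 : 0 ≤ e := div_nonneg (by linarith) hd0.le
  have he : e + 1 / d = 1 := by simp only [e]; field_simp; ring
  have he1 : e ≤ 1 := by have : 0 < 1 / (d : ℝ) := by positivity
                         linarith
  refine ⟨1 / (48 * d * (4 * K)), by positivity, 3 ^ ⌊1 + C⌋₊ + 1, fun n S Q hn hS => ?_⟩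
  have hn2 : 2 ≤ n := by
    have : 1 ≤ 3 ^ ⌊1 + C⌋₊ := Nat.one_le_pow _ _ (by norm_num)
    lia
  have hn0 : (0 : ℝ) < n := by exact_mod_cast (by lia : 0 < n)
  obtain ⟨hSn, hlog⟩ := hS.card_le (by lia)
  have hS0 : 0 < S := hn0.trans_le hSn
  refine ⟨hn0, hS0, ?_⟩
  -- Since n exceeds 3^⌊1 + C⌋, fewer than `1 + C` navigations cannot reach every point.
  have hQ1 : 1 ≤ Q := by
    by_contra! hlt
    have : ⌊Q + C⌋₊ ≤ ⌊1 + C⌋₊ := Nat.floor_mono (by linarith)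
    have := Nat.pow_le_pow_right (show 0 < 3 by norm_num) this
    lia
  set c : ℝ := 1 / (48 * d * (4 * K))
  have hc0 : 0 < c := by positivity
  set Y : ℝ := ((n : ℝ) ^ 2 / S) ^ e
  by_contra! hlt
  set s : ℝ := K * S / n
  have hs1 : 1 ≤ s := by
    rw [one_le_div hn0]
    nlinarith
  obtain ⟨p, hp, hmp, hpm⟩ := Nat.exists_prime_lt_and_le_two_mul ⌈s⌉₊
    (Nat.ceil_pos.2 (by linarith)).ne'
  have hps : s < p := (Nat.le_ceil s).trans_lt (by exact_mod_cast hmp)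
  have hp4 : (p : ℝ) ≤ 4 * s := by
    have h1 : (p : ℝ) ≤ 2 * ⌈s⌉₊ := by exact_mod_cast hpm
    have h2 := (Nat.ceil_lt_add_one (zero_le_one.trans hs1)).le
    linarith
  have hp0 : (0 : ℝ) < p := by exact_mod_cast hp.pos
  obtain ⟨q, hq0, hqp, hpq⟩ := Nat.exists_pow_lt_le_two_mul_pow (d := d) (by lia) hp.two_le
  obtain ⟨m, hm0, hmn, hnm⟩ := Nat.exists_pow_lt_le_two_mul_pow (d := d) (by lia) hn2
  have hq0' : (0 : ℝ) < q := by exact_mod_cast hq0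
  have hroot : ∀ {x : ℝ}, 0 < x → x ^ e * x ^ (1 / (d : ℝ)) = x := fun hx => by
    rw [← Real.rpow_add hx, he, Real.rpow_one]
  have hpr : (p : ℝ) ^ (1 / (d : ℝ)) ≤ 2 * q := by
    have h1 : (p : ℝ) ≤ (2 * q : ℝ) ^ d := by exact_mod_cast hpq
    rw [one_div, ← Real.pow_rpow_inv_natCast (x := 2 * q) (n := d) (by positivity) (by lia)]
    gcongr
  have hmr : (m : ℝ) ≤ (n : ℝ) ^ (1 / (d : ℝ)) := by
    have h1 : (m : ℝ) ^ d ≤ n := by exact_mod_cast hmn.le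
    rw [one_div, ← Real.pow_rpow_inv_natCast (x := m) (n := d) (by positivity) (by lia)]
    gcongr
  have hpdq : (p : ℝ) / q ≤ 2 * (p : ℝ) ^ e := by
    rw [div_le_iff₀ hq0']
    calc (p : ℝ) = (p : ℝ) ^ e * (p : ℝ) ^ (1 / (d : ℝ)) := (hroot hp0).symm
      _ ≤ (p : ℝ) ^ e * (2 * q) := by gcongr
      _ = _ := by ring
  have hpY : (p : ℝ) ^ e * Y ≤ 4 * K * (n : ℝ) ^ e := by
    calc (p : ℝ) ^ e * Y ≤ (4 * s) ^ e * Y := by gcongr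
      _ = (4 * K * n) ^ e := by
          rw [← Real.mul_rpow (by positivity) (by positivity)]
          congr 1
          simp only [s]
          field_simp
      _ = (4 * K) ^ e * (n : ℝ) ^ e := Real.mul_rpow (by positivity) hn0.le
      _ ≤ 4 * K * (n : ℝ) ^ e := by
          gcongr
          exact Real.rpow_le_self_of_one_le (by linarith) he1
  -- With grid side 2m, the number of values is O(p^e n^(1/d)), and p^e Y = O(n^e) with e + 1/d = 1;
  -- the factors collect to 48d · 4K, which fixes `c`.
  have hcond : 2 * ((2 * (d * p * (2 * m) / q : ℕ) + 1) * (2 * c * Y)) ≤ n := by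
    have hl : ((d * p * (2 * m) / q : ℕ) : ℝ) ≤ d * (p / q) * (2 * m) := by
      refine Nat.cast_div_le.trans (le_of_eq ?_)
      push_cast
      ring
    have hone : (1 : ℝ) ≤ d * (p / q) * (2 * m) := by
      have h1 : (1 : ℝ) ≤ p / q := by
        rw [one_le_div hq0']
        exact_mod_cast (Nat.le_self_pow (by lia) q).trans hqp.le
      have h2 : (1 : ℝ) ≤ m := by exact_mod_cast hm0
      nlinarith [mul_le_mul hd2 h1 zero_le_one hd0.le]
    calc 2 * ((2 * (d * p * (2 * m) / q : ℕ) + 1) * (2 * c * Y))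
        ≤ 2 * ((3 * (d * (p / q) * (2 * m))) * (2 * c * Y)) := by
          have : 0 ≤ Y := by positivity
          gcongr
          linarith
      _ ≤ 2 * ((3 * (d * (2 * (p : ℝ) ^ e) * (2 * (n : ℝ) ^ (1 / (d : ℝ))))) * (2 * c * Y)) := by
          have : 0 ≤ Y := by positivity
          gcongr
      _ = 48 * d * c * (n : ℝ) ^ (1 / (d : ℝ)) * ((p : ℝ) ^ e * Y) := by ring
      _ ≤ 48 * d * c * (n : ℝ) ^ (1 / (d : ℝ)) * (4 * K * (n : ℝ) ^ e) := by gcongr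
      _ = (48 * d * (4 * K) * c) * ((n : ℝ) ^ e * (n : ℝ) ^ (1 / (d : ℝ))) := by ring
      _ = n := by
          rw [hroot hn0, mul_one_div_cancel (by positivity), one_mul]
  -- The factor 2 in `h` secures h ≥ 2, as 1 ≤ Q < cY.
  have := hS.mul_le_size (by lia) hp hq0 hqp hnm (h := 2 * c * Y) (by linarith) (by linarith)
    hcond (g := g) (by linarith)
  have h1 : K * S < p * n := (div_lt_iff₀ hn0).1 hps
  have h2 : K * S = 8 * (d - 1 : ℕ) * 9 ^ g * S + S := by ring
  linarith

theorem mainTheorem1 (d : ℕ) (hd : 2 ≤ d) (C : ℝ) (hC : 0 < C) :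
    (∃ c : ℝ, 0 < c ∧ ∃ n₀ : ℕ, ∀ S Q : ℕ → ℝ,
      (∀ n : ℕ, SolvesSimplexReporting d n (S n) (Q n) C) →
      ∀ n : ℕ, n₀ ≤ n →
        c * ((n : ℝ) ^ 2 / S n) ^ (((d : ℝ) - 1) / (d : ℝ)) ≤ Q n ∧
        ∀ k : ℕ, k ≤ n →
          c * (((n : ℝ) ^ 2 / S n) ^ (((d : ℝ) - 1) / (d : ℝ)) + (k : ℝ)) ≤ Q n + C * (k : ℝ)) ∧
    (∀ a : ℝ, 0 < a → ∃ c : ℝ, 0 < c ∧ ∃ n₀ : ℕ, ∀ S Q : ℕ → ℝ,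
      (∀ n : ℕ, SolvesSimplexReporting d n (S n) (Q n) C) →
      ∀ n : ℕ, n₀ ≤ n → S n ≤ a * (n : ℝ) →
        c * (n : ℝ) ^ (1 - 1 / (d : ℝ)) ≤ Q n ∧
        ∀ k : ℕ, k ≤ n →
          c * ((n : ℝ) ^ (1 - 1 / (d : ℝ)) + (k : ℝ)) ≤ Q n + C * (k : ℝ)) := by
  obtain ⟨c, hc, n₀, h⟩ := SolvesSimplexReporting.le_query_time hd C
  have hd0 : (0 : ℝ) < d := by exact_mod_cast (by lia : 0 < d)
  have he0 : 0 ≤ ((d : ℝ) - 1) / d := by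
    have : (2 : ℝ) ≤ d := by exact_mod_cast hd
    exact div_nonneg (by linarith) hd0.le
  -- The term Ck already pays for k, so the minimum of the two constants serves both summands.
  have key : ∀ {c Z Q : ℝ}, 0 ≤ Z → c * Z ≤ Q → min c C * Z ≤ Q ∧
      ∀ k : ℕ, min c C * (Z + k) ≤ Q + C * k := fun {c Z Q} hZ hQ => by
    have h1 : min c C * Z ≤ Q := (mul_le_mul_of_nonneg_right (min_le_left _ _) hZ).trans hQ
    refine ⟨h1, fun k => ?_⟩
    have h2 : min c C * k ≤ C * k := by gcongr; exact min_le_right _ _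
    linarith
  refine ⟨⟨min c C, lt_min hc hC, n₀, fun S Q hS n hn => ?_⟩, fun a ha =>
    ⟨min (c / a ^ (((d : ℝ) - 1) / d)) C, lt_min (by positivity) hC, n₀, fun S Q hS n hn hSa => ?_⟩⟩
  · obtain ⟨hn0, hS0, hQ⟩ := h n _ _ hn (hS n)
    exact (key (by positivity) hQ).imp_right fun h k _ => h k
  · obtain ⟨hn0, hS0, hQ⟩ := h n _ _ hn (hS n)
    refine (key (by positivity) (le_trans ?_ hQ)).imp_right fun h k _ => h k
    have he : 1 - 1 / (d : ℝ) = ((d : ℝ) - 1) / d := by field_simp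
    rw [he, div_mul_eq_mul_div, mul_div_assoc, ← Real.div_rpow hn0.le ha.le]
    -- Linear space gives n/a ≤ n²/S; the power of `a` was absorbed into the constant.
    refine mul_le_mul_of_nonneg_left (Real.rpow_le_rpow (by positivity) ?_ he0) hc.le
    rw [div_le_div_iff₀ ha hS0]
    nlinarith
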